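/- Let $d>1$ be an integer and order $\mathbb{N}^d$ componentwise. A generalized numerical semigroup is an additive submonoid $S\subseteq\mathbb{N}^d$ whose set of gaps $\mathcal H(S)=\mathbb{N}^d\setminus S$ is finite; its embedding dimension is the cardinality of its unique minimal set of generators. Put $$\operatorname{PF}(S)=\{h\in\mathcal H(S): h+s\in S\ \text{for all}\ s\in S\setminus\{0\}\},$$ and let $\operatorname{FA}(S)$ be the set of maximal elements of $\mathcal H(S)$. The semigroup $S$ is called symmetric if $|\operatorname{PF}(S)|=1$, and almost symmetric if $\operatorname{FA}(S)=\{f\}$ for some $f$ and $f-p\in\operatorname{PF}(S)$ for all $p\in\operatorname{PF}(S)\setminus\{f\}$. Let $S\subseteq\mathbb{N}^d$ be a generalized numerical semigroup with embedding dimension $2d+1$. Then $S$ is symmetric if and only if $|\operatorname{FA}(S)|=1$. Moreover, $S$ is almost symmetric if and only if it is symmetric. Furthermore, a submonoid $S\subseteq\mathbb{N}^d$ is a symmetric generalized numerical semigroup of embedding dimension $2d+1$ if and only if $d=2$ and, up to a permutation of the two coordinates, there are integers $a_2>3$ and $d_2\ge 1$ such that either 1. $a_2\equiv 1\pmod 3$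 and $S=\langle(3,0),(a_2,0),(a_2+1,0),(0,1),(1,d_2)\rangle$, or 2. $\gcd(3,a_2)=1$ and $S=\langle(3,0),(a_2,0),(0,1),(1,d_2),(2,d_2)\rangle$. -/

import Mathlib

/-- A generalized numerical semigroup in `ℕ^d` is an additive submonoid with finite complement. -/
def IsGNS {d : ℕ} (S : AddSubmonoid (Fin d → ℕ)) : Prop :=
  ((S : Set (Fin d → ℕ))ᶜ).Finite

/-- The set `H(S)` of gaps. -/
def gapSet {d : ℕ} (S : AddSubmonoid (Fin d → ℕ)) : Set (Fin d → ℕ) :=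
  (S : Set (Fin d → ℕ))ᶜ

/-- `A` generates `S` and no proper subset of `A` does. -/
def IsMinimalGeneratingSet {d : ℕ} (S : AddSubmonoid (Fin d → ℕ)) (A : Set (Fin d → ℕ)) : Prop :=
  AddSubmonoid.closure A = S ∧ ∀ B : Set (Fin d → ℕ), B ⊂ A → AddSubmonoid.closure B ≠ S

/-- `S` has embedding dimension `n`: it has a finite minimal set of generators, of cardinality `n`.
(The minimal set of generators of a submonoid of `ℕ^d` is unique.) -/
def HasEmbeddingDimension {d : ℕ} (S : AddSubmonoid (Fin d → ℕ)) (n : ℕ) : Prop :=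
  ∃ A : Finset (Fin d → ℕ), IsMinimalGeneratingSet S (A : Set (Fin d → ℕ)) ∧ A.card = n

/-- The set `PF(S)` of pseudo-Frobenius elements. -/
def pseudoFrobeniusSet {d : ℕ} (S : AddSubmonoid (Fin d → ℕ)) : Set (Fin d → ℕ) :=
  {h | h ∈ gapSet S ∧ ∀ s ∈ S, s ≠ 0 → h + s ∈ S}

/-- The type `t(S)`, the number of pseudo-Frobenius elements. -/
noncomputable def gnsType {d : ℕ} (S : AddSubmonoid (Fin d → ℕ)) : ℕ :=
  (pseudoFrobeniusSet S).ncard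

/-- The set `FA(S)` of Frobenius-allowable elements: the maximal gaps for the componentwise
order. -/
def frobeniusAllowableSet {d : ℕ} (S : AddSubmonoid (Fin d → ℕ)) : Set (Fin d → ℕ) :=
  {h | Maximal (fun x => x ∈ gapSet S) h}

/-- `S` is symmetric: its type is `1`. -/
def IsSymmetricGNS {d : ℕ} (S : AddSubmonoid (Fin d → ℕ)) : Prop :=
  gnsType S = 1

/-- `S` is almost symmetric: `FA(S) = {f}`, and `f - p ∈ PF(S)` for all `p ∈ PF(S)` other
than `f`. The difference is that of `ℤ^d`, so it is written as `p + q = f` with `q ∈ PF(S)`. -/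
def IsAlmostSymmetricGNS {d : ℕ} (S : AddSubmonoid (Fin d → ℕ)) : Prop :=
  ∃ f : Fin d → ℕ, frobeniusAllowableSet S = {f} ∧
    ∀ p ∈ pseudoFrobeniusSet S, p ≠ f → ∃ q ∈ pseudoFrobeniusSet S, p + q = f

/-- The monoid `⟨(3,0), (a,0), (a+1,0), (0,1), (1,b)⟩`, where the first coordinate is the one
with index `i` and the second one that with index `j`. -/
def firstFamily {d : ℕ} (i j : Fin d) (a b : ℕ) : AddSubmonoid (Fin d → ℕ) :=
  AddSubmonoid.closure
    {Pi.single i 3, Pi.single i a, Pi.single i (a + 1), Pi.single j 1,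
      Pi.single i 1 + Pi.single j b}

/-- The monoid `⟨(3,0), (a,0), (0,1), (1,b), (2,b)⟩`, where the first coordinate is the one
with index `i` and the second one that with index `j`. -/
def secondFamily {d : ℕ} (i j : Fin d) (a b : ℕ) : AddSubmonoid (Fin d → ℕ) :=
  AddSubmonoid.closure
    {Pi.single i 3, Pi.single i a, Pi.single j 1,
      Pi.single i 1 + Pi.single j b, Pi.single i 2 + Pi.single j b}

/-! Everything follows from a classification of the semigroups with embedding dimension 2d+1 and a
single maximal gap f. Symmetry and almost symmetry each force such an f, while every semigroup in
the resulting list is symmetric.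

The minimal generators are the atoms, so the argument counts atoms. Every gap is ≤ f. As f is a sum
of axis vectors, some (f i)·e_i is a gap, and so is e_i. This already yields 2d atoms: the smallest
on each of the d axes, a second one q·e_i on axis i, and e_i + k_l·e_l for each l ≠ i. Exactly one
atom v is left. If another e_j were a gap, two further atoms would appear, so all other unit vectors
lie in S. This is `exists_oneAxisData`.

If v is off axis i, the axis monoid is generated by p and q, hence is closed under the symmetry n ↦
f i - n from gaps to elements. This forces k_l = f l + 1. Then 2e_i + k_j·e_j produces a new atom
for every j ≠ i, so there is only one such j, d = 2, p = 3, and the second family appears.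

If v is on axis i, an element of S is an axis element plus copies of the e_i + k_l·e_l, up to unit
vectors. Let n be least with (f i - n)·e_i in S; then f j + 1 = n·k_j. Mixing two different
directions would put f in S, so d = 2. Also p ≤ n + 1, so the p - 1 axis elements just after f i + 1
are all atoms. Only q and v are available, whence p = 3 and the first family. -/

/-- `x` is an indecomposable nonzero element of `S`. -/
def IsAtomOf {d : ℕ} (S : AddSubmonoid (Fin d → ℕ)) (x : Fin d → ℕ) : Prop :=
  x ∈ S ∧ x ≠ 0 ∧ ∀ y ∈ S, ∀ z ∈ S, x = y + z → y = 0 ∨ z = 0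

/-! ### Atoms as minimal generators, and ways to produce them -/

section Atoms

variable {d : ℕ} {S : AddSubmonoid (Fin d → ℕ)}

theorem IsAtomOf.mem_of_closure_eq {B : Set (Fin d → ℕ)} (hB : AddSubmonoid.closure B = S)
    {x : Fin d → ℕ} (hx : IsAtomOf S x) : x ∈ B := by
  obtain ⟨hxS, hx0, hx⟩ := hx
  have key : ∀ y ∈ AddSubmonoid.closure B, y ≠ 0 → y = x → y ∈ B := by
    intro y hy
    induction hy using AddSubmonoid.closure_induction with
    | mem y hy => exact fun _ _ => hy
    | zero => exact fun h => absurd rfl h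
    | add y z hy hz ihy ihz =>
      intro h0 hyz
      rw [hB] at hy hz
      rcases hx y hy z hz hyz.symm with h | h
      · subst h; simp only [zero_add] at *; exact ihz h0 hyz
      · subst h; simp only [add_zero] at *; exact ihy h0 hyz
  exact key x (hB ▸ hxS) hx0 rfl

/-- A proper summand of a is not ≥ a, so a cannot occur in an expression for it. If a decomposed, it
would be generated by the other elements of A. -/
theorem IsMinimalGeneratingSet.isAtomOf {A : Set (Fin d → ℕ)} (hA : IsMinimalGeneratingSet S A)
    {a : Fin d → ℕ} (ha : a ∈ A) : IsAtomOf S a := by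
  obtain ⟨hcl, hmin⟩ := hA
  have hnot : a ∉ AddSubmonoid.closure (A \ {a}) := by
    intro h
    refine hmin (A \ {a}) ⟨Set.sdiff_subset, fun h' => (h' ha).2 rfl⟩ ?_
    rw [← hcl]
    refine le_antisymm (AddSubmonoid.closure_mono Set.sdiff_subset) ?_
    rw [AddSubmonoid.closure_le]
    intro b hb
    by_cases hba : b = a
    · rw [hba]; exact h
    · exact AddSubmonoid.subset_closure ⟨hb, hba⟩
  have key : ∀ y ∈ AddSubmonoid.closure A, ¬ a ≤ y → y ∈ AddSubmonoid.closure (A \ {a}) := by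
    intro y hy
    induction hy using AddSubmonoid.closure_induction with
    | mem y hy =>
      exact fun h => AddSubmonoid.subset_closure ⟨hy, fun h' => h (le_of_eq h'.symm)⟩
    | zero => exact fun _ => zero_mem _
    | add y z hy hz ihy ihz =>
      exact fun h => add_mem (ihy fun h' => h (h'.trans le_self_add))
        (ihz fun h' => h (h'.trans le_add_self))
  refine ⟨hcl ▸ AddSubmonoid.subset_closure ha, fun h => hnot (h ▸ zero_mem _), ?_⟩
  intro y hy z hz hyz
  by_contra! hne
  rw [← hcl] at hy hz
  have aux : ∀ u w : Fin d → ℕ, a = u + w → a ≤ u → w = 0 := by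
    intro u w h hle
    rw [h] at hle
    ext l
    have := hle l
    simp only [Pi.add_apply, Pi.zero_apply] at *
    omega
  apply hnot
  rw [hyz]
  rw [hyz] at key aux
  exact add_mem (key y hy fun h => hne.2 (aux y z rfl h))
    (key z hz fun h => hne.1 (aux z y (add_comm _ _) h))

theorem isMinimalGeneratingSet_of_isAtomOf {A : Set (Fin d → ℕ)}
    (hcl : AddSubmonoid.closure A = S) (hA : ∀ a ∈ A, IsAtomOf S a) :
    IsMinimalGeneratingSet S A :=
  ⟨hcl, fun _ hB hBS => hB.2 fun a ha => (hA a ha).mem_of_closure_eq hBS⟩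

theorem eq_single_of_le {i : Fin d} {x : ℕ} {h : Fin d → ℕ} (hle : h ≤ Pi.single i x) :
    h = Pi.single i (h i) := by
  ext l
  have := hle l
  by_cases hl : l = i
  · subst hl; simp
  · simp_all

theorem eq_add_single_of_le {i j : Fin d} (hij : i ≠ j) {x y : ℕ} {h : Fin d → ℕ}
    (hle : h ≤ Pi.single i x + Pi.single j y) :
    h = Pi.single i (h i) + Pi.single j (h j) := by
  ext l
  have := hle l
  by_cases hl : l = i
  · subst hl; simp [hij]
  · by_cases hl' : l = j
    · subst hl'; simp [hl]
    · simp_all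

theorem isAtomOf_single {i : Fin d} {x : ℕ} (hx : Pi.single i x ∈ S) (hx0 : x ≠ 0)
    (h : ∀ y z : ℕ, Pi.single i y ∈ S → Pi.single i z ∈ S → x = y + z → y = 0 ∨ z = 0) :
    IsAtomOf S (Pi.single i x) := by
  refine ⟨hx, by simpa using hx0, ?_⟩
  intro y hy z hz hyz
  have h1 : y = Pi.single i (y i) := eq_single_of_le (le_self_add.trans hyz.symm.le)
  have h2 : z = Pi.single i (z i) := eq_single_of_le (le_add_self.trans hyz.symm.le)
  have h3 : x = y i + z i := by simpa using congrFun hyz i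
  rw [h1] at hy
  rw [h2] at hz
  rcases h _ _ hy hz h3 with h | h
  · left; rw [h1, h]; simp
  · right; rw [h2, h]; simp

/-- The least c is taken subject to both memberships. Keeping the remainder x - c in S is what later
excludes c = 1. -/
theorem exists_isAtomOf_single_add_single {i j : Fin d} (hij : i ≠ j) {x : ℕ}
    (hx : Pi.single j 1 + Pi.single i x ∈ S) :
    ∃ c ≤ x, IsAtomOf S (Pi.single j 1 + Pi.single i c) ∧ Pi.single i (x - c) ∈ S := by
  classical
  have hex : ∃ c, c ≤ x ∧ Pi.single j 1 + Pi.single i c ∈ S ∧ Pi.single i (x - c) ∈ S :=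
    ⟨x, le_rfl, hx, by simp⟩
  obtain ⟨hcx, hcS, hcT⟩ := Nat.find_spec hex
  have hmin := fun m => Nat.find_min (m := m) hex
  generalize Nat.find hex = c at hcx hcS hcT hmin
  have aux : ∀ y ∈ S, ∀ z ∈ S, Pi.single j 1 + Pi.single i c = y + z → y j = 0 → y = 0 := by
    intro y hy z hz hyz hyj
    have h1 := eq_add_single_of_le hij.symm (h := y) (le_self_add.trans hyz.symm.le)
    have h2 := eq_add_single_of_le hij.symm (h := z) (le_add_self.trans hyz.symm.le)
    have h3 := congrFun hyz i
    have h4 := congrFun hyz j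
    simp [hij, hij.symm] at h3 h4
    have hzj : z j = 1 := by omega
    rw [hyj, Pi.single_zero, zero_add] at h1
    rw [hzj] at h2
    by_contra h0
    have hyi : y i ≠ 0 := fun h => h0 (by rw [h1, h, Pi.single_zero])
    refine hmin (z i) (by omega) ⟨by omega, h2 ▸ hz, ?_⟩
    have : x - z i = (x - c) + y i := by omega
    rw [this, Pi.single_add]
    exact add_mem hcT (h1 ▸ hy)
  refine ⟨c, hcx, ⟨hcS, fun h => by simpa [hij] using congrFun h j, ?_⟩, hcT⟩
  intro y hy z hz hyz
  have h4 := congrFun hyz j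
  simp [hij.symm] at h4
  rcases Nat.eq_zero_or_pos (y j) with h | h
  · exact Or.inl (aux y hy z hz hyz h)
  · exact Or.inr (aux z hz y hy (by rw [hyz, add_comm]) (by omega))

theorem exists_isAtomOf_or_decomposition {i j : Fin d} (hij : i ≠ j) {x y : ℕ} (hx : x ≠ 0)
    (h : Pi.single i x + Pi.single j y ∈ S) :
    ∃ y' ≤ y, IsAtomOf S (Pi.single i x + Pi.single j y') ∨
      ∃ x₁ x₂ y₁ y₂, 0 < x₁ ∧ 0 < x₂ ∧ x₁ + x₂ = x ∧ y₁ + y₂ = y' ∧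
        Pi.single i x₁ + Pi.single j y₁ ∈ S ∧ Pi.single i x₂ + Pi.single j y₂ ∈ S := by
  classical
  have hex : ∃ c, Pi.single i x + Pi.single j c ∈ S := ⟨y, h⟩
  have hc := Nat.find_spec hex
  have hcy := Nat.find_min' hex h
  have hmin := fun m => Nat.find_min' (m := m) hex
  generalize Nat.find hex = c at hc hcy hmin
  refine ⟨c, hcy, ?_⟩
  by_contra! hcon
  obtain ⟨hna, hnd⟩ := hcon
  apply hna
  refine ⟨hc, fun h0 => hx (by simpa [hij] using congrFun h0 i), ?_⟩
  intro u hu w hw huw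
  have h1 := eq_add_single_of_le hij (h := u) (le_self_add.trans huw.symm.le)
  have h2 := eq_add_single_of_le hij (h := w) (le_add_self.trans huw.symm.le)
  have h3 := congrFun huw i
  have h4 := congrFun huw j
  simp [hij, hij.symm] at h3 h4
  rw [h1] at hu
  rw [h2] at hw
  rcases Nat.eq_zero_or_pos (u i) with hui | hui
  · left
    have hwi : w i = x := by omega
    rw [hwi] at hw
    have := hmin _ hw
    have huj : u j = 0 := by omega
    rw [h1, hui, huj]; simp
  · rcases Nat.eq_zero_or_pos (w i) with hwi | hwi
    · right
      have hui' : u i = x := by omega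
      rw [hui'] at hu
      have := hmin _ hu
      have hwj : w j = 0 := by omega
      rw [h2, hwi, hwj]; simp
    · exact absurd hw (hnd _ _ _ _ hui hwi h3.symm h4.symm hu)

theorem exists_isAtomOf_single (i : Fin d) {x : ℕ} (hx0 : x ≠ 0) (hx : Pi.single i x ∈ S) :
    ∃ p, 0 < p ∧ IsAtomOf S (Pi.single i p) ∧ ∀ y, 0 < y → Pi.single i y ∈ S → p ≤ y := by
  classical
  have hex : ∃ p, 0 < p ∧ Pi.single i p ∈ S := ⟨x, Nat.pos_of_ne_zero hx0, hx⟩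
  obtain ⟨hp0, hpS⟩ := Nat.find_spec hex
  have hmin : ∀ y, 0 < y → Pi.single i y ∈ S → Nat.find hex ≤ y :=
    fun y hy hyS => Nat.find_min' hex ⟨hy, hyS⟩
  refine ⟨_, hp0, isAtomOf_single hpS hp0.ne' ?_, hmin⟩
  intro y z hy hz hyz
  by_contra! hne
  have := hmin y (by omega) hy
  omega

theorem exists_isAtomOf_single_not_dvd (i : Fin d) {p x : ℕ} (hxp : ¬ p ∣ x)
    (hx : Pi.single i x ∈ S) : ∃ q, IsAtomOf S (Pi.single i q) ∧ ¬ p ∣ q := by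
  classical
  have hex : ∃ q, ¬ p ∣ q ∧ Pi.single i q ∈ S := ⟨x, hxp, hx⟩
  obtain ⟨hq, hqS⟩ := Nat.find_spec hex
  have hmin := fun m => Nat.find_min (m := m) hex
  generalize Nat.find hex = q at *
  refine ⟨q, isAtomOf_single hqS (fun h => hq (h ▸ dvd_zero p)) ?_, hq⟩
  intro y z hy hz hyz
  by_contra! hne
  have h1 : p ∣ y := by
    by_contra h; exact hmin y (by omega) ⟨h, hy⟩
  have h2 : p ∣ z := by
    by_contra h; exact hmin z (by omega) ⟨h, hz⟩
  exact hq (hyz ▸ dvd_add h1 h2)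

/-- In a submonoid of `ℕ` generated by two elements, `F - n` is an element whenever `n` is not,
`F` being the largest nonelement. -/
theorem mem_sub_of_two_generators {T : AddSubmonoid ℕ} {p q F n : ℕ} (hp : p ∈ T) (hq : q ∈ T)
    (hp0 : 0 < p) (hT : ∀ x ∈ T, ∃ α β, x = α * p + β * q) (hF : F ∉ T)
    (hgt : ∀ x, F < x → x ∈ T) (hn : n ∉ T) : n ≤ F ∧ F - n ∈ T := by
  classical
  have hmul : ∀ α β, α * p + β * q ∈ T := fun α β => by
    simpa using add_mem (nsmul_mem hp α) (nsmul_mem hq β)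
  -- As F is not in T, no p occurs here: F + p = β₀q. Likewise the first element n + (c+1)p of T
  -- equals βq. If β > β₀, then n + cp > F would lie in T; so subtracting gives F - n = cp + (β₀ -
  -- β)q.
  obtain ⟨α₀, β₀, h0⟩ := hT (F + p) (hgt _ (by omega))
  have hα₀ : α₀ = 0 := by
    by_contra h
    obtain ⟨k, rfl⟩ := Nat.exists_eq_succ_of_ne_zero h
    apply hF
    have : F = k * p + β₀ * q := by
      rw [Nat.succ_mul] at h0; omega
    rw [this]; exact hmul _ _
  subst hα₀
  have hex : ∃ c, n + c * p ∈ T := ⟨F + 1, hgt _ (by nlinarith)⟩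
  have hc := Nat.find_spec hex
  have hmin := fun m => Nat.find_min (m := m) hex
  generalize Nat.find hex = c at hc hmin
  have hc0 : c ≠ 0 := by rintro rfl; simp at hc; exact hn hc
  obtain ⟨c, rfl⟩ := Nat.exists_eq_succ_of_ne_zero hc0
  have hcm := hmin c (by omega)
  obtain ⟨α, β, h1⟩ := hT _ hc
  rw [Nat.succ_mul] at h1
  have hα : α = 0 := by
    by_contra h
    obtain ⟨k, rfl⟩ := Nat.exists_eq_succ_of_ne_zero h
    apply hcm
    have : n + c * p = k * p + β * q := by
      rw [Nat.succ_mul] at h1; omega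
    rw [this]; exact hmul _ _
  subst hα
  have hβ : β ≤ β₀ := by
    by_contra! h
    apply hcm
    apply hgt
    have hq0 : 0 < q := by
      rcases Nat.eq_zero_or_pos q with h | h
      · subst h; omega
      · exact h
    have := Nat.mul_lt_mul_of_pos_right h hq0
    omega
  obtain ⟨e, rfl⟩ := Nat.exists_eq_add_of_le hβ
  have hk : F = n + (c * p + e * q) := by
    rw [add_mul] at h0; omega
  refine ⟨by omega, ?_⟩
  rw [hk, Nat.add_sub_cancel_left]
  exact hmul _ _

end Atoms

/-! ### The two families: membership modulo 3 and symmetry -/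

section Families

variable {i j : Fin 2}

theorem fin_two_eq_or_eq (hij : i ≠ j) (l : Fin 2) : l = i ∨ l = j := by omega

theorem ext_of_ne (hij : i ≠ j) {h h' : Fin 2 → ℕ} (h1 : h i = h' i) (h2 : h j = h' j) :
    h = h' := by
  ext l
  rcases fin_two_eq_or_eq hij l with rfl | rfl <;> assumption

theorem ne_of_coords {g g' : Fin 2 → ℕ} (h : g i ≠ g' i ∨ g j ≠ g' j) : g ≠ g' := by
  rintro rfl
  simp at h

theorem mem_of_base {S : AddSubmonoid (Fin 2 → ℕ)} (hij : i ≠ j) (h3 : Pi.single i 3 ∈ S)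
    (h1 : Pi.single j 1 ∈ S) {h : Fin 2 → ℕ} (x y n m : ℕ)
    (hxy : Pi.single i x + Pi.single j y ∈ S) (hi : h i = x + 3 * n) (hj : h j = y + m) :
    h ∈ S := by
  have : h = (Pi.single i x + Pi.single j y) + (n • Pi.single i 3 + m • Pi.single j 1) := by
    apply ext_of_ne hij
    · simp [hij, hi]; ring
    · simp [hij.symm, hj]
  rw [this]
  exact add_mem hxy (add_mem (nsmul_mem h3 n) (nsmul_mem h1 m))

/-- Modulo (3,0) and (0,1), only the class of the first coordinate matters. The bound is a ≤ h i + 1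
because a - 1 is itself a multiple of 3. -/
theorem mem_firstFamily_iff (hij : i ≠ j) {a b : ℕ} (ha3 : a % 3 = 1)
    (h : Fin 2 → ℕ) : h ∈ firstFamily i j a b ↔
      h i % 3 = 0 ∨ a ≤ h i + 1 ∨ (h i % 3 = 1 ∧ b ≤ h j) ∨ (h i % 3 = 2 ∧ 2 * b ≤ h j) := by
  constructor
  · intro hh
    induction hh using AddSubmonoid.closure_induction with
    | mem x hx =>
      simp only [Set.mem_insert_iff, Set.mem_singleton_iff] at hx
      rcases hx with rfl | rfl | rfl | rfl | rfl <;> (simp [hij, hij.symm]; try omega)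
    | zero => simp
    | add x y _ _ hx hy =>
      simp only [Pi.add_apply]
      omega
  · intro hh
    have hg : ∀ g ∈ ({Pi.single i 3, Pi.single i a, Pi.single i (a + 1), Pi.single j 1,
      Pi.single i 1 + Pi.single j b} : Set (Fin 2 → ℕ)), g ∈ firstFamily i j a b :=
      fun g hg => AddSubmonoid.subset_closure hg
    have g3 := hg (Pi.single i 3) (by simp)
    have ga := hg (Pi.single i a) (by simp)
    have gb := hg (Pi.single i (a + 1)) (by simp)
    have g1 := hg (Pi.single j 1) (by simp)
    have gc := hg (Pi.single i 1 + Pi.single j b) (by simp)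
    have key := @mem_of_base i j _ hij g3 g1 h
    have k0 := fun n m => key 0 0 n m (by simp)
    have ka := fun n m => key a 0 n m (by simpa using ga)
    have kb := fun n m => key (a + 1) 0 n m (by simpa using gb)
    have kc := fun n m => key 1 b n m gc
    have kd := fun n m => key 2 (2 * b) n m (by
      have := add_mem gc gc
      convert this using 1
      apply ext_of_ne hij
      · simp [hij]
      · simp [hij.symm]; ring)
    by_cases h0 : h i % 3 = 0
    · exact k0 (h i / 3) (h j) (by omega) (by omega)
    by_cases h1 : h i % 3 = 1
    · by_cases h2 : a ≤ h i
      · exact ka ((h i - a) / 3) (h j) (by omega) (by omega)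
      · exact kc (h i / 3) (h j - b) (by omega) (by omega)
    · by_cases h2 : a ≤ h i
      · exact kb ((h i - (a + 1)) / 3) (h j) (by omega) (by omega)
      · exact kd (h i / 3) (h j - 2 * b) (by omega) (by omega)

theorem mem_secondFamily_iff (hij : i ≠ j) {a b : ℕ}
    (h : Fin 2 → ℕ) : h ∈ secondFamily i j a b ↔
      h i % 3 = 0 ∨ (h i % 3 = a % 3 ∧ a ≤ h i) ∨ (h i % 3 = (2 * a) % 3 ∧ 2 * a ≤ h i) ∨
        b ≤ h j := by
  constructor
  · intro hh
    induction hh using AddSubmonoid.closure_induction with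
    | mem x hx =>
      simp only [Set.mem_insert_iff, Set.mem_singleton_iff] at hx
      rcases hx with rfl | rfl | rfl | rfl | rfl <;> simp [hij, hij.symm]
    | zero => simp
    | add x y _ _ hx hy =>
      simp only [Pi.add_apply]
      omega
  · intro hh
    have hg : ∀ g ∈ ({Pi.single i 3, Pi.single i a, Pi.single j 1,
      Pi.single i 1 + Pi.single j b, Pi.single i 2 + Pi.single j b} : Set (Fin 2 → ℕ)),
      g ∈ secondFamily i j a b :=
      fun g hg => AddSubmonoid.subset_closure hg
    have g3 := hg (Pi.single i 3) (by simp)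
    have ga := hg (Pi.single i a) (by simp)
    have g1 := hg (Pi.single j 1) (by simp)
    have gc := hg (Pi.single i 1 + Pi.single j b) (by simp)
    have gd := hg (Pi.single i 2 + Pi.single j b) (by simp)
    have key := @mem_of_base i j _ hij g3 g1 h
    have k0 := fun n m => key 0 0 n m (by simp)
    have ka := fun n m => key a 0 n m (by simpa using ga)
    have kb := fun n m => key (2 * a) 0 n m (by
      simpa [two_mul, Pi.single_add] using add_mem ga ga)
    have kc := fun n m => key 1 b n m gc
    have kd := fun n m => key 2 b n m gd
    by_cases h0 : h i % 3 = 0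
    · exact k0 (h i / 3) (h j) (by omega) (by omega)
    by_cases h1 : b ≤ h j
    · by_cases h2 : h i % 3 = 1
      · exact kc (h i / 3) (h j - b) (by omega) (by omega)
      · exact kd (h i / 3) (h j - b) (by omega) (by omega)
    · by_cases h2 : h i % 3 = a % 3
      · exact ka ((h i - a) / 3) (h j) (by omega) (by omega)
      · exact kb ((h i - 2 * a) / 3) (h j) (by omega) (by omega)

theorem isGNS_of_bound {S : AddSubmonoid (Fin 2 → ℕ)} (hij : i ≠ j) (x y : ℕ)
    (h : ∀ h : Fin 2 → ℕ, h ∉ S → h i ≤ x ∧ h j ≤ y) : IsGNS S := by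
  refine (Set.finite_Iic (Pi.single i x + Pi.single j y)).subset fun g hg l => ?_
  obtain ⟨h1, h2⟩ := h g hg
  rcases fin_two_eq_or_eq hij l with rfl | rfl
  · simpa [hij] using h1
  · simpa [hij.symm] using h2

theorem isSymmetricGNS_of_unique {S : AddSubmonoid (Fin 2 → ℕ)} (hij : i ≠ j) (x y : ℕ)
    (h : ∀ h, h ∈ pseudoFrobeniusSet S ↔ h i = x ∧ h j = y) : IsSymmetricGNS S := by
  have : pseudoFrobeniusSet S = {Pi.single i x + Pi.single j y} := by
    ext g
    rw [h, Set.mem_singleton_iff]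
    constructor
    · rintro ⟨h1, h2⟩
      apply ext_of_ne hij
      · simpa [hij] using h1
      · simpa [hij.symm] using h2
    · rintro rfl
      simp [hij, hij.symm]
  rw [IsSymmetricGNS, gnsType, this, Set.ncard_singleton]

theorem isAtomOf_of_coords {S : AddSubmonoid (Fin 2 → ℕ)} (hij : i ≠ j) {x : Fin 2 → ℕ}
    (hx : x ∈ S) (h0 : 0 < x i + x j)
    (h : ∀ u ∈ S, ∀ w ∈ S, x i = u i + w i → x j = u j + w j → u i + u j = 0 ∨ w i + w j = 0) :
    IsAtomOf S x := by
  refine ⟨hx, fun h => by simp [h] at h0, fun u hu w hw huw => ?_⟩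
  have := h u hu w hw (congrFun huw i) (congrFun huw j)
  refine this.imp (fun h => ?_) (fun h => ?_) <;>
  · apply ext_of_ne hij <;> simp only [Pi.zero_apply] <;> omega

theorem firstFamily_properties (hij : i ≠ j) {a b : ℕ} (ha : 3 < a) (hb : 0 < b)
    (ha3 : a % 3 = 1) : IsGNS (firstFamily i j a b) ∧
      HasEmbeddingDimension (firstFamily i j a b) (2 * 2 + 1) ∧
      IsSymmetricGNS (firstFamily i j a b) := by
  have hmem := mem_firstFamily_iff (b := b) hij ha3
  refine ⟨isGNS_of_bound hij a (2 * b) fun h hh => by rw [hmem] at hh; omega, ?_, ?_⟩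
  · refine ⟨{Pi.single i 3, Pi.single i a, Pi.single i (a + 1), Pi.single j 1,
      Pi.single i 1 + Pi.single j b}, isMinimalGeneratingSet_of_isAtomOf ?_ ?_, ?_⟩
    · simp [firstFamily]
    · intro g hg
      have hgS : g ∈ firstFamily i j a b := AddSubmonoid.subset_closure (by simpa using hg)
      simp only [Finset.coe_insert, Finset.coe_singleton, Set.mem_insert_iff,
        Set.mem_singleton_iff] at hg
      rcases hg with rfl | rfl | rfl | rfl | rfl <;>
      · refine isAtomOf_of_coords hij hgS (by simp [hij, hij.symm]; try omega) ?_
        intro u hu w hw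
        rw [hmem] at hu hw
        simp [hij, hij.symm]
        omega
    · repeat rw [Finset.card_insert_of_notMem]
      · simp
      all_goals
        simp only [Finset.mem_insert, Finset.mem_singleton, not_or]
        repeat' apply And.intro
        all_goals
          refine ne_of_coords (i := i) (j := j) ?_
          simp [hij, hij.symm]
          try omega
  -- a - 2 is the largest axis gap. It is 2 mod 3, a class that enters S at height 2b.
  · refine isSymmetricGNS_of_unique hij (a - 2) (2 * b - 1) fun h => ?_
    constructor
    · rintro ⟨hg, hs⟩
      have e3 := hs (Pi.single i 3) (by rw [hmem]; simp) (by simp)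
      have e1 := hs (Pi.single j 1) (by rw [hmem]; simp [hij]) (by simp)
      have eb := hs (Pi.single i 1 + Pi.single j b) (by rw [hmem]; simp [hij, hij.symm])
        (fun h => by simpa [hij] using congrFun h i)
      rw [gapSet, Set.mem_compl_iff, SetLike.mem_coe, hmem] at hg
      rw [hmem] at e3 e1 eb
      simp [hij, hij.symm] at e3 e1 eb
      omega
    · rintro ⟨h1, h2⟩
      refine ⟨?_, fun s hs hs0 => ?_⟩
      · rw [gapSet, Set.mem_compl_iff, SetLike.mem_coe, hmem]; omega
      · have : s i ≠ 0 ∨ s j ≠ 0 := by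
          by_contra! h
          exact hs0 (ext_of_ne hij h.1 h.2)
        rw [hmem] at hs ⊢
        simp only [Pi.add_apply]
        omega

theorem secondFamily_properties (hij : i ≠ j) {a b : ℕ} (ha : 3 < a) (hb : 0 < b)
    (ha3 : a % 3 ≠ 0) : IsGNS (secondFamily i j a b) ∧
      HasEmbeddingDimension (secondFamily i j a b) (2 * 2 + 1) ∧
      IsSymmetricGNS (secondFamily i j a b) := by
  have hmem := mem_secondFamily_iff (a := a) (b := b) hij
  refine ⟨isGNS_of_bound hij (2 * a) b fun h hh => by rw [hmem] at hh; omega, ?_, ?_⟩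
  · refine ⟨{Pi.single i 3, Pi.single i a, Pi.single j 1,
      Pi.single i 1 + Pi.single j b, Pi.single i 2 + Pi.single j b},
      isMinimalGeneratingSet_of_isAtomOf ?_ ?_, ?_⟩
    · simp [secondFamily]
    · intro g hg
      have hgS : g ∈ secondFamily i j a b := AddSubmonoid.subset_closure (by simpa using hg)
      simp only [Finset.coe_insert, Finset.coe_singleton, Set.mem_insert_iff,
        Set.mem_singleton_iff] at hg
      rcases hg with rfl | rfl | rfl | rfl | rfl <;>
      · refine isAtomOf_of_coords hij hgS (by simp [hij, hij.symm]; try omega) ?_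
        intro u hu w hw
        rw [hmem] at hu hw
        simp [hij, hij.symm]
        omega
    · repeat rw [Finset.card_insert_of_notMem]
      · simp
      all_goals
        simp only [Finset.mem_insert, Finset.mem_singleton, not_or]
        repeat' apply And.intro
        all_goals
          refine ne_of_coords (i := i) (j := j) ?_
          simp [hij, hij.symm]
          try omega
  -- 2a - 3 is the Frobenius number of ⟨3, a⟩, and everything of height at least b lies in S.
  · refine isSymmetricGNS_of_unique hij (2 * a - 3) (b - 1) fun h => ?_
    constructor
    · rintro ⟨hg, hs⟩
      have e3 := hs (Pi.single i 3) (by rw [hmem]; simp) (by simp)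
      have ea := hs (Pi.single i a) (by rw [hmem]; simp) (by simp; omega)
      have e1 := hs (Pi.single j 1) (by rw [hmem]; simp [hij]) (by simp)
      rw [gapSet, Set.mem_compl_iff, SetLike.mem_coe, hmem] at hg
      rw [hmem] at e3 ea e1
      simp [hij, hij.symm] at e3 ea e1
      omega
    · rintro ⟨h1, h2⟩
      refine ⟨?_, fun s hs hs0 => ?_⟩
      · rw [gapSet, Set.mem_compl_iff, SetLike.mem_coe, hmem]; omega
      · have : s i ≠ 0 ∨ s j ≠ 0 := by
          by_contra! h
          exact hs0 (ext_of_ne hij h.1 h.2)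
        rw [hmem] at hs ⊢
        simp only [Pi.add_apply]
        omega

end Families

/-! ### Counting atoms: one special axis and one extra atom -/

/-- `S` has the largest gap `f`, contains all unit vectors but the `i`-th one, and has as atoms
those unit vectors, two vectors on the `i`-th axis, one vector of first coordinate `1` in each
coordinate plane through that axis, and one more vector `v`. -/
structure OneAxisData {d : ℕ} (S : AddSubmonoid (Fin d → ℕ)) (f : Fin d → ℕ) (i : Fin d)
    (p q : ℕ) (k : Fin d → ℕ) (v : Fin d → ℕ) : Prop where
  closure_atoms : AddSubmonoid.closure {x | IsAtomOf S x} = S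
  notMem : f ∉ S
  le_of_notMem : ∀ h, h ∉ S → h ≤ f
  axis_notMem : Pi.single i (f i) ∉ S
  unit_mem : ∀ j, j ≠ i → Pi.single j 1 ∈ S
  one_lt : 1 < p
  not_dvd : ¬ p ∣ q
  atom_p : IsAtomOf S (Pi.single i p)
  p_le : ∀ y, 0 < y → Pi.single i y ∈ S → p ≤ y
  atom_q : IsAtomOf S (Pi.single i q)
  atom_k : ∀ l, l ≠ i → IsAtomOf S (Pi.single i 1 + Pi.single l (k l))
  k_le : ∀ l, l ≠ i → ∀ y, Pi.single i 1 + Pi.single l y ∈ S → k l ≤ y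
  k_pos : ∀ l, l ≠ i → 0 < k l
  atom_v : IsAtomOf S v
  v_ne_p : v ≠ Pi.single i p
  v_ne_q : v ≠ Pi.single i q
  v_ne_unit : ∀ j, j ≠ i → v ≠ Pi.single j 1
  v_ne_k : ∀ l, l ≠ i → v ≠ Pi.single i 1 + Pi.single l (k l)
  atom_cases : ∀ x, IsAtomOf S x → x = Pi.single i p ∨ x = Pi.single i q ∨
    (∃ j, j ≠ i ∧ x = Pi.single j 1) ∨ (∃ l, l ≠ i ∧ x = Pi.single i 1 + Pi.single l (k l)) ∨ x = v

theorem exists_oneAxisData {d : ℕ} {S : AddSubmonoid (Fin d → ℕ)} {A : Finset (Fin d → ℕ)}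
    (hcl : AddSubmonoid.closure (A : Set (Fin d → ℕ)) = S) (hA : ∀ x, x ∈ A ↔ IsAtomOf S x)
    (hcard : A.card = 2 * d + 1) {f : Fin d → ℕ} (hf : f ∉ S) (hle : ∀ h, h ∉ S → h ≤ f) :
    ∃ i p q k v, OneAxisData S f i p q k v := by
  classical
  have hbig : ∀ (h : Fin d → ℕ) (l : Fin d), f l < h l → h ∈ S := by
    intro h l hl
    by_contra hh
    have : h l ≤ f l := hle h hh l
    omega
  obtain ⟨i, hi⟩ : ∃ i, Pi.single i (f i) ∉ S := by
    by_contra! h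
    apply hf
    rw [← Finset.univ_sum_single f]
    exact sum_mem fun l _ => h l
  have hi1 : Pi.single i 1 ∉ S := by
    intro h
    apply hi
    simpa [← Pi.single_smul] using nsmul_mem h (f i)
  have hP : ∀ l, ∃ p, 0 < p ∧ IsAtomOf S (Pi.single l p) ∧
      ∀ y, 0 < y → Pi.single l y ∈ S → p ≤ y := fun l =>
    exists_isAtomOf_single l (Nat.succ_ne_zero (f l)) (hbig _ l (by simp))
  choose P hP0 hPa hPmin using hP
  have hPone : ∀ l, Pi.single l 1 ∉ S → 1 < P l := by
    intro l hl
    have h1 : P l ≠ 1 := fun h => hl (h ▸ (hPa l).1)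
    have := hP0 l
    omega
  have hQ : ∀ l, Pi.single l 1 ∉ S → ∃ q, IsAtomOf S (Pi.single l q) ∧ ¬ P l ∣ q := by
    intro l hl
    have hP1 := hPone l hl
    -- Both f l + 1 and f l + 2 lie on the axis part of S, and P l > 1 cannot divide both.
    by_cases h : P l ∣ f l + 1
    · refine exists_isAtomOf_single_not_dvd l (x := f l + 2) (fun h' => ?_)
        (hbig _ l (by simp))
      have h1 : P l ∣ f l + 1 + 1 := h'
      have := Nat.le_of_dvd one_pos ((Nat.dvd_add_right h).1 h1)
      omega
    · exact exists_isAtomOf_single_not_dvd l h (hbig _ l (by simp))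
  have hK : ∀ l, ∃ k, l ≠ i → IsAtomOf S (Pi.single i 1 + Pi.single l k) ∧
      ∀ y, Pi.single i 1 + Pi.single l y ∈ S → k ≤ y := by
    intro l
    by_cases hl : l = i
    · exact ⟨0, fun h => absurd hl h⟩
    have hex : ∃ k, Pi.single i 1 + Pi.single l k ∈ S :=
      ⟨f l + 1, hbig _ l (by simp [hl])⟩
    obtain ⟨c, hc, hca, -⟩ := exists_isAtomOf_single_add_single hl (Nat.find_spec hex)
    refine ⟨c, fun _ => ⟨hca, fun y hy => hc.trans (Nat.find_min' hex hy)⟩⟩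
  choose k hk using hK
  have hka := fun l hl => (hk l hl).1
  have hkmin := fun l hl => (hk l hl).2
  have hkpos : ∀ l, l ≠ i → 0 < k l := by
    intro l hl
    rw [Nat.pos_iff_ne_zero]
    intro h
    have := (hka l hl).1
    rw [h] at this
    exact hi1 (by simpa using this)
  obtain ⟨q, hqa, hq⟩ := hQ i hi1
  have hPinj : Function.Injective fun l => (Pi.single l (P l) : Fin d → ℕ) := by
    intro l m hlm
    by_contra hne
    have := congrFun hlm l
    have h0 := hP0 l
    simp [hne] at this
    omega
  have hGinj : Set.InjOn (fun l => (Pi.single i 1 + Pi.single l (k l) : Fin d → ℕ))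
      (Finset.univ.erase i : Finset (Fin d)) := by
    intro l hl m hm hlm
    have hl' : l ≠ i := by simpa using hl
    by_contra hne
    have := congrFun hlm l
    have h0 := hkpos l hl'
    simp [hne, hl'] at this
    omega
  let B₁ : Finset (Fin d → ℕ) := Finset.univ.image fun l => Pi.single l (P l)
  let B₂ : Finset (Fin d → ℕ) :=
    (Finset.univ.erase i).image fun l => Pi.single i 1 + Pi.single l (k l)
  have hB₁ : B₁.card = d := by
    rw [Finset.card_image_of_injective _ hPinj]; simp
  have hB₂ : B₂.card = d - 1 := by
    rw [Finset.card_image_of_injOn hGinj]; simp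
  have hdisj : Disjoint B₁ B₂ := by
    rw [Finset.disjoint_left]
    intro x hx hx'
    obtain ⟨l, -, rfl⟩ := Finset.mem_image.1 hx
    obtain ⟨m, hm, hlm⟩ := Finset.mem_image.1 hx'
    have hm' : m ≠ i := by simpa using hm
    have h1 := congrFun hlm i
    have h2 := congrFun hlm m
    have h3 := hkpos m hm'
    by_cases hl : l = i
    · subst hl
      simp [hm'] at h2
      omega
    · simp [Ne.symm hm', Ne.symm hl] at h1
  have hqB : Pi.single i q ∉ B₁ ∪ B₂ := by
    intro h
    rcases Finset.mem_union.1 h with h | h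
    · obtain ⟨l, -, hl⟩ := Finset.mem_image.1 h
      have h1 := congrFun hl i
      by_cases hli : l = i
      · subst hli
        simp at h1
        exact hq (h1 ▸ dvd_rfl)
      · simp [Ne.symm hli] at h1
        exact hq (h1 ▸ dvd_zero _)
    · obtain ⟨m, hm, hlm⟩ := Finset.mem_image.1 h
      have hm' : m ≠ i := by simpa using hm
      have h2 := congrFun hlm m
      have h3 := hkpos m hm'
      simp [hm'] at h2
      omega
  let B := insert (Pi.single i q) (B₁ ∪ B₂)
  have hd : 0 < d := i.pos
  have hB : B.card = 2 * d := by
    rw [Finset.card_insert_of_notMem hqB, Finset.card_union_of_disjoint hdisj, hB₁, hB₂]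
    omega
  have hmemB : ∀ x, x ∈ B ↔ x = Pi.single i q ∨ (∃ l, Pi.single l (P l) = x) ∨
      ∃ l, l ≠ i ∧ Pi.single i 1 + Pi.single l (k l) = x := by
    intro x
    simp [B, B₁, B₂]
  have hBA : B ⊆ A := by
    intro x hx
    rw [hA]
    rcases (hmemB x).1 hx with rfl | ⟨l, rfl⟩ | ⟨l, hl, rfl⟩
    · exact hqa
    · exact hPa l
    · exact hka l hl
  obtain ⟨v, hv⟩ : ∃ v, A \ B = {v} := by
    rw [← Finset.card_eq_one, Finset.card_sdiff_of_subset hBA]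
    omega
  have hAB : ∀ x, IsAtomOf S x → x ∈ B ∨ x = v := by
    intro x hx
    by_cases h : x ∈ B
    · exact Or.inl h
    · right
      have : x ∈ A \ B := Finset.mem_sdiff.2 ⟨(hA x).2 hx, h⟩
      simpa [hv] using this
  have hvB : v ∈ A \ B := by simp [hv]
  obtain ⟨hvA, hvB⟩ := Finset.mem_sdiff.1 hvB
  -- Otherwise a second atom on axis j and an atom e_j + c·e_i with c ≥ 2 would both have to be v.
  have hunit : ∀ j, j ≠ i → Pi.single j 1 ∈ S := by
    intro j hj
    by_contra hj1
    obtain ⟨q', hqa', hq'⟩ := hQ j hj1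
    obtain ⟨c, hc, hca, hcT⟩ := exists_isAtomOf_single_add_single (S := S) hj.symm (x := f i + 1)
      (hbig _ i (by simp [hj.symm]))
    have hc0 : c ≠ 0 := by
      rintro rfl
      exact hj1 (by simpa using hca.1)
    -- With x = f i + 1, the value c = 1 would leave the remainder (f i)·e_i, which is a gap.
    have hc1 : c ≠ 1 := by
      rintro rfl
      exact hi (by simpa using hcT)
    have hq0 : q' ≠ 0 := fun h => hq' (h ▸ dvd_zero _)
    have e1 : Pi.single j q' = v := by
      refine (hAB _ hqa').resolve_left fun h => ?_
      rcases (hmemB _).1 h with h | ⟨l, h⟩ | ⟨l, hl, h⟩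
      · have := congrFun h j
        simp [hj, hq0] at this
      · have := congrFun h j
        by_cases hlj : l = j
        · subst hlj
          simp at this
          exact hq' (this ▸ dvd_rfl)
        · simp [Ne.symm hlj] at this
          exact hq0 this.symm
      · have := congrFun h i
        simp [hl.symm, hj.symm] at this
    have e2 : Pi.single j 1 + Pi.single i c = v := by
      refine (hAB _ hca).resolve_left fun h => ?_
      rcases (hmemB _).1 h with h | ⟨l, h⟩ | ⟨l, hl, h⟩
      · have := congrFun h j
        simp [hj] at this
      · have h1 := congrFun h j
        have h2 := congrFun h i
        by_cases hlj : l = j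
        · subst hlj
          simp [hj.symm] at h2
          omega
        · simp [Ne.symm hlj, hj] at h1
      · have := congrFun h i
        simp [hl.symm, hj.symm] at this
        omega
    have := congrFun (e1.trans e2.symm) i
    simp [hj.symm] at this
    omega
  have hP1 : ∀ j, j ≠ i → P j = 1 := by
    intro j hj
    have := hPmin j 1 one_pos (hunit j hj)
    have := hP0 j
    omega
  refine ⟨i, P i, q, k, v, ?_⟩
  rw [hmemB] at hvB
  push Not at hvB
  obtain ⟨hv1, hv2, hv3⟩ := hvB
  exact
  { closure_atoms := by
      rw [← hcl]
      congr 1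
      ext x
      simp [hcl, hA]
    notMem := hf
    le_of_notMem := hle
    axis_notMem := hi
    unit_mem := hunit
    one_lt := hPone i hi1
    not_dvd := hq
    atom_p := hPa i
    p_le := hPmin i
    atom_q := hqa
    atom_k := hka
    k_le := hkmin
    k_pos := hkpos
    atom_v := (hA v).1 hvA
    v_ne_p := (hv2 i).symm
    v_ne_q := hv1
    v_ne_unit := fun j hj => by
      have := (hv2 j).symm
      rwa [hP1 j hj] at this
    v_ne_k := fun l hl => (hv3 l hl).symm
    atom_cases := by
      intro x hx
      rcases hAB x hx with h | h
      · rcases (hmemB x).1 h with h | ⟨l, h⟩ | ⟨l, hl, h⟩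
        · exact Or.inr (Or.inl h)
        · by_cases hl : l = i
          · rw [hl] at h
            exact Or.inl h.symm
          · rw [hP1 l hl] at h
            exact Or.inr (Or.inr (Or.inl ⟨l, hl, h.symm⟩))
        · exact Or.inr (Or.inr (Or.inr (Or.inl ⟨l, hl, h.symm⟩)))
      · exact Or.inr (Or.inr (Or.inr (Or.inr h))) }

/-- An element u ≤ F is congruent to F + 1 modulo p, since otherwise adding multiples of p to u
reaches one of the forbidden F - m. Taking u = 0 shows that all elements up to F are multiples of p.
Nonzero summands of F + 1 + m are at least p > m, hence at most F, so p would divide m. -/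
theorem dvd_and_atoms_above_of_gaps {T : AddSubmonoid ℕ} {F p : ℕ} (hp : p ∈ T)
    (hp0 : 0 < p) (hmin : ∀ y, 0 < y → y ∈ T → p ≤ y)
    (hgap : ∀ m, m + 1 < p → m ≤ F → F - m ∉ T) :
    p ∣ F + 1 ∧ ∀ m, 0 < m → m < p → ∀ y ∈ T, ∀ z ∈ T, F + 1 + m = y + z → y = 0 ∨ z = 0 := by
  have key : ∀ u ∈ T, u ≤ F → p ∣ F + 1 - u := by
    intro u hu huF
    rw [Nat.dvd_iff_mod_eq_zero]
    by_contra hr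
    have h1 := Nat.div_add_mod (F + 1 - u) p
    have h2 := Nat.mod_lt (F + 1 - u) hp0
    generalize (F + 1 - u) % p = r at *
    generalize (F + 1 - u) / p = c at *
    apply hgap (r - 1) (by omega) (by omega)
    have : F - (r - 1) = u + c * p := by rw [mul_comm c]; omega
    rw [this]
    exact add_mem hu (by simpa using nsmul_mem hp c)
  have hdvd : p ∣ F + 1 := key 0 (zero_mem _) (Nat.zero_le _)
  refine ⟨hdvd, fun m hm hmp y hy z hz hyz => ?_⟩
  by_contra! hne
  have hy1 := hmin y (by omega) hy
  have hz1 := hmin z (by omega) hz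
  have aux : ∀ u ∈ T, u ≤ F → p ∣ u := fun u hu huF => by
    have := Nat.dvd_sub hdvd (key u hu huF)
    rwa [Nat.sub_sub_self (by omega)] at this
  have h1 := dvd_add (aux y hy (by omega)) (aux z hz (by omega))
  rw [← hyz] at h1
  have := Nat.le_of_dvd hm ((Nat.dvd_add_right hdvd).1 h1)
  omega

theorem eq_two_of_forall_eq_or_eq {d : ℕ} {i j : Fin d} (hij : i ≠ j)
    (h : ∀ l, l ≠ i → l = j) : d = 2 := by
  have : (Finset.univ : Finset (Fin d)) = {i, j} := by
    ext l
    by_cases hl : l = i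
    · simp [hl]
    · simp [h l hl]
  have h2 := congrArg Finset.card this
  rwa [Finset.card_pair hij, Finset.card_univ, Fintype.card_fin] at h2

/-! ### General consequences of the atom structure -/

namespace OneAxisData

variable {d : ℕ} {S : AddSubmonoid (Fin d → ℕ)} {f : Fin d → ℕ} {i : Fin d} {p q : ℕ}
  {k v : Fin d → ℕ}

theorem mem_of_lt (D : OneAxisData S f i p q k v) {h : Fin d → ℕ} (l : Fin d) (hl : f l < h l) :
    h ∈ S := by
  by_contra hh
  have : h l ≤ f l := D.le_of_notMem h hh l
  omega

theorem mem_of_axis_mem (D : OneAxisData S f i p q k v) {h : Fin d → ℕ}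
    (hh : Pi.single i (h i) ∈ S) : h ∈ S := by
  rw [← Finset.univ_sum_single h]
  refine sum_mem fun l _ => ?_
  by_cases hl : l = i
  · rw [hl]; exact hh
  · simpa [← Pi.single_smul] using nsmul_mem (D.unit_mem l hl) (h l)

theorem mem_of_le (D : OneAxisData S f i p q k v) {h h' : Fin d → ℕ} (hh : h ∈ S) (hle : h ≤ h')
    (hi : h i = h' i) : h' ∈ S := by
  rw [← add_tsub_cancel_of_le hle]
  refine add_mem hh (D.mem_of_axis_mem ?_)
  simp [hi]

/-- The source of most contradictions: such an h below f could be raised to f by unit vectors other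
than e_i. -/
theorem not_le_of_mem (D : OneAxisData S f i p q k v) {h : Fin d → ℕ} (hh : h ∈ S)
    (hi : h i = f i) : ¬ h ≤ f :=
  fun hle => D.notMem (D.mem_of_le hh hle hi)

theorem one_notMem (D : OneAxisData S f i p q k v) : Pi.single i 1 ∉ S := fun h => by
  have := D.p_le 1 one_pos h
  have := D.one_lt
  omega

theorem eq_of_le_v (D : OneAxisData S f i p q k v) {h : Fin d → ℕ} (hle : h ≤ v) (h0 : h ≠ 0)
    (hh : h ∈ S) (hs : Pi.single i (v i - h i) ∈ S) : v = h := by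
  have h1 := (add_tsub_cancel_of_le hle).symm
  rcases D.atom_v.2.2 h hh (v - h) (D.mem_of_axis_mem (by simpa using hs)) h1 with h2 | h2
  · exact absurd h2 h0
  · rw [h2, add_zero] at h1
    exact h1

theorem v_apply_ne_zero (D : OneAxisData S f i p q k v) : v i ≠ 0 := by
  intro h
  obtain ⟨j, hj⟩ := Function.ne_iff.1 D.atom_v.2.1
  rw [Pi.zero_apply] at hj
  have hji : j ≠ i := fun h' => hj (h' ▸ h)
  refine D.v_ne_unit j hji (D.eq_of_le_v (fun l => ?_) (by simp) (D.unit_mem j hji) (by simp [h]))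
  by_cases hl : l = j
  · subst hl; simp; omega
  · simp [hl]

/-! ### Extra atom off the axis: the second family -/

theorem axis_mem_two_generators (D : OneAxisData S f i p q k v) (hoff : v ≠ Pi.single i (v i))
    {x : ℕ} (hx : Pi.single i x ∈ S) : ∃ α β, x = α * p + β * q := by
  have key : ∀ h ∈ AddSubmonoid.closure {x | IsAtomOf S x}, h = Pi.single i (h i) →
      ∃ α β, h i = α * p + β * q := by
    intro h hh
    induction hh using AddSubmonoid.closure_induction with
    | mem h hh =>
      intro he
      rcases D.atom_cases h hh with rfl | rfl | ⟨j, hj, rfl⟩ | ⟨l, hl, rfl⟩ | rfl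
      · exact ⟨1, 0, by simp⟩
      · exact ⟨0, 1, by simp⟩
      · have := congrFun he j
        simp [hj] at this
      · have := congrFun he l
        have h0 := D.k_pos l hl
        simp [hl] at this
        omega
      · exact absurd he hoff
    | zero => exact fun _ => ⟨0, 0, by simp⟩
    | add y z _ _ ihy ihz =>
      intro he
      obtain ⟨α, β, h1⟩ := ihy (eq_single_of_le (le_self_add.trans he.le))
      obtain ⟨α', β', h2⟩ := ihz (eq_single_of_le (le_add_self.trans he.le))
      exact ⟨α + α', β + β', by rw [Pi.add_apply, h1, h2]; ring⟩
  have := key (Pi.single i x) (by rw [D.closure_atoms]; exact hx) (by simp)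
  simpa using this

theorem mem_sub_of_off_axis (D : OneAxisData S f i p q k v) (hoff : v ≠ Pi.single i (v i))
    {n : ℕ} (hn : Pi.single i n ∉ S) : n ≤ f i ∧ Pi.single i (f i - n) ∈ S :=
  mem_sub_of_two_generators (T := S.comap (AddMonoidHom.single (fun _ => ℕ) i)) (p := p) (q := q)
    D.atom_p.1 D.atom_q.1 (by have := D.one_lt; omega)
    (fun _ hx => D.axis_mem_two_generators hoff hx) D.axis_notMem
    (fun x hx => D.mem_of_lt (h := Pi.single i x) i (by simpa using hx)) hn

theorem k_eq_of_off_axis (D : OneAxisData S f i p q k v) (hoff : v ≠ Pi.single i (v i))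
    {l : Fin d} (hl : l ≠ i) : k l = f l + 1 := by
  apply le_antisymm
  · exact D.k_le l hl _ (D.mem_of_lt l (by simp [hl]))
  · by_contra! hlt
    -- As 1 is an axis gap, f i - 1 is an axis element; adding it to e_i + k_l·e_l gives first
    -- coordinate exactly f i.
    obtain ⟨h1, h2⟩ := D.mem_sub_of_off_axis hoff D.one_notMem
    refine D.not_le_of_mem (add_mem (D.atom_k l hl).1 h2) (by simp [hl.symm]; omega) fun m => ?_
    by_cases hm : m = i
    · subst hm; simp [hl.symm]; omega
    · by_cases hm' : m = l
      · subst hm'; simp [hm]; omega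
      · simp [hm, hm']

theorem mem_of_off_axis (D : OneAxisData S f i p q k v) (hoff : v ≠ Pi.single i (v i))
    {l : Fin d} (hl : l ≠ i) (x : ℕ) : Pi.single i x + Pi.single l (k l) ∈ S :=
  D.mem_of_lt l (by simp [hl, D.k_eq_of_off_axis hoff hl])

theorem v_axis_notMem (D : OneAxisData S f i p q k v) (hoff : v ≠ Pi.single i (v i)) :
    Pi.single i (v i) ∉ S := by
  intro h
  refine hoff (D.eq_of_le_v (fun l => ?_) (by simpa using D.v_apply_ne_zero) h (by simp))
  by_cases hl : l = i
  · subst hl; simp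
  · simp [hl]

theorem exists_v_eq_of_off_axis (D : OneAxisData S f i p q k v)
    (hoff : v ≠ Pi.single i (v i)) :
    ∃ l, l ≠ i ∧ v = Pi.single i (v i) + Pi.single l (k l) := by
  obtain ⟨h1, h2⟩ := D.mem_sub_of_off_axis hoff (D.v_axis_notMem hoff)
  -- Raising v to first coordinate f i shows that v exceeds f in some direction l ≠ i, so v l ≥ k l.
  have h3 := D.not_le_of_mem (add_mem D.atom_v.1 h2) (by simp; omega)
  rw [Pi.le_def] at h3
  push Not at h3
  obtain ⟨l, hl⟩ := h3
  have hli : l ≠ i := by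
    rintro rfl
    simp at hl
    omega
  simp [hli] at hl
  refine ⟨l, hli, D.eq_of_le_v (fun m => ?_) (fun h => ?_) (D.mem_of_off_axis hoff hli _) ?_⟩
  · by_cases hm : m = i
    · subst hm; simp [hli.symm]
    · by_cases hm' : m = l
      · subst hm'; simp [hm, D.k_eq_of_off_axis hoff hli]; omega
      · simp [hm, hm']
  · have := congrFun h i
    simp [hli.symm] at this
    exact D.v_apply_ne_zero this
  · simp [hli.symm]

theorem secondFamily_of_off_axis (D : OneAxisData S f i p q k v)
    (hoff : v ≠ Pi.single i (v i)) :
    d = 2 ∧ ∃ j, i ≠ j ∧ 3 < q ∧ 0 < k j ∧ Nat.Coprime 3 q ∧ S = secondFamily i j q (k j) := by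
  obtain ⟨l, hl, hv⟩ := D.exists_v_eq_of_off_axis hoff
  have hv0 := D.v_apply_ne_zero
  have hv1 : v i ≠ 1 := fun h => D.v_ne_k l hl (by rw [h] at hv; exact hv)
  have h2 : Pi.single i 2 ∉ S := by
    intro h
    by_cases hv2 : v i = 2
    · exact D.v_axis_notMem hoff (by rw [hv2]; exact h)
    · have hk := D.k_pos l hl
      have h3 := D.atom_v.2.2 _ h _ (D.mem_of_off_axis hoff hl (v i - 2)) (by
        rw [← add_assoc, ← Pi.single_add, Nat.add_sub_cancel' (by omega)]
        exact hv)
      rcases h3 with h3 | h3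
      · simp at h3
      · have := congrFun h3 l
        simp [hl] at this
        omega
  -- The lowest element above 2e_i in direction j has height at most k_j. A splitting 1 + 1 would
  -- cost 2k_j, so it is an atom, necessarily v.
  have hall : ∀ j, j ≠ i → j = l ∧ v i = 2 := by
    intro j hj
    have hkj := D.k_pos j hj
    obtain ⟨y, hy, hat | ⟨x₁, x₂, y₁, y₂, hx₁, hx₂, hx, hyy, hm₁, hm₂⟩⟩ :=
      exists_isAtomOf_or_decomposition hj.symm two_ne_zero (D.mem_of_off_axis hoff hj 2)
    · rcases D.atom_cases _ hat with h | h | ⟨m, hm, h⟩ | ⟨m, hm, h⟩ | h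
      · have := congrFun h i
        simp [hj.symm] at this
        exact absurd D.atom_p.1 (this ▸ h2)
      · have := congrFun h i
        simp [hj.symm] at this
        exact absurd D.atom_q.1 (this ▸ h2)
      · have := congrFun h i
        simp [hj.symm, hm.symm] at this
      · have := congrFun h i
        simp [hj.symm, hm.symm] at this
      · have e1 := congrFun h i
        simp [hj.symm] at e1
        refine ⟨?_, e1.symm⟩
        by_contra hjl
        have e2 := congrFun (h.trans hv) l
        have hk := D.k_pos l hl
        simp [hl, Ne.symm hjl] at e2
        omega
    · obtain rfl : x₁ = 1 := by omega
      obtain rfl : x₂ = 1 := by omega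
      have := D.k_le j hj _ hm₁
      have := D.k_le j hj _ hm₂
      omega
  have hv2 := (hall l hl).2
  have h3 : Pi.single i 3 ∈ S := by
    by_contra h3
    have hkl := D.k_pos l hl
    obtain ⟨y, hy, hat | ⟨x₁, x₂, y₁, y₂, hx₁, hx₂, hx, hyy, hm₁, hm₂⟩⟩ :=
      exists_isAtomOf_or_decomposition hl.symm three_ne_zero (D.mem_of_off_axis hoff hl 3)
    · rcases D.atom_cases _ hat with h | h | ⟨m, hm, h⟩ | ⟨m, hm, h⟩ | h
      · have := congrFun h i
        simp [hl.symm] at this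
        exact absurd D.atom_p.1 (this ▸ h3)
      · have := congrFun h i
        simp [hl.symm] at this
        exact absurd D.atom_q.1 (this ▸ h3)
      · have := congrFun h i
        simp [hl.symm, hm.symm] at this
      · have := congrFun h i
        simp [hl.symm, hm.symm] at this
      · have := congrFun h i
        simp [hl.symm] at this
        omega
    · have aux : ∀ y, Pi.single i 2 + Pi.single l y ∈ S → y ≠ 0 := by
        rintro y hy rfl
        exact h2 (by simpa using hy)
      obtain ⟨rfl, rfl⟩ | ⟨rfl, rfl⟩ : (x₁ = 1 ∧ x₂ = 2) ∨ (x₁ = 2 ∧ x₂ = 1) := by omega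
      · have := D.k_le l hl _ hm₁
        have := aux _ hm₂
        omega
      · have := D.k_le l hl _ hm₂
        have := aux _ hm₁
        omega
  have hp3 : p = 3 := by
    have e1 := D.p_le 3 (by norm_num) h3
    have e2 := D.one_lt
    have e3 : p ≠ 2 := fun h => h2 (h ▸ D.atom_p.1)
    omega
  have hq3 := D.not_dvd
  rw [hp3] at hq3
  refine ⟨eq_two_of_forall_eq_or_eq hl.symm fun j hj => (hall j hj).1, l, hl.symm, ?_,
    D.k_pos l hl, (Nat.Prime.coprime_iff_not_dvd Nat.prime_three).2 hq3, le_antisymm ?_ ?_⟩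
  · have hq0 : q ≠ 0 := by rintro rfl; simp at hq3
    have := D.p_le q (by omega) D.atom_q.1
    omega
  · conv_lhs => rw [← D.closure_atoms]
    refine AddSubmonoid.closure_mono fun x hx => ?_
    simp only [Set.mem_insert_iff, Set.mem_singleton_iff]
    rcases D.atom_cases x hx with h | h | ⟨m, hm, h⟩ | ⟨m, hm, h⟩ | h
    · rw [hp3] at h; simp [h]
    · simp [h]
    · rw [(hall m hm).1] at h; simp [h]
    · rw [(hall m hm).1] at h; simp [h]
    · rw [hv2] at hv; rw [h, hv]; simp
  · refine AddSubmonoid.closure_le.2 fun x hx => ?_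
    simp only [Set.mem_insert_iff, Set.mem_singleton_iff] at hx
    rcases hx with rfl | rfl | rfl | rfl | rfl
    · exact h3
    · exact D.atom_q.1
    · exact D.unit_mem l hl
    · exact (D.atom_k l hl).1
    · exact D.mem_of_off_axis hoff hl 2

/-! ### Extra atom on the axis: the first family -/

/-- Here c l counts the copies of e_i + k_l·e_l used and s is the total from axis i. Unit vectors
only add slack to the heights. -/
theorem exists_weights (D : OneAxisData S f i p q k v) {t : ℕ} (hv : v = Pi.single i t)
    {h : Fin d → ℕ} (hh : h ∈ S) : ∃ (c : Fin d → ℕ) (s : ℕ), Pi.single i s ∈ S ∧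
      s + ∑ l ∈ Finset.univ.erase i, c l = h i ∧ ∀ l, l ≠ i → c l * k l ≤ h l := by
  rw [← D.closure_atoms] at hh
  induction hh using AddSubmonoid.closure_induction with
  | mem h hh =>
    have axis : ∀ x, h = Pi.single i x → ∃ (c : Fin d → ℕ) (s : ℕ), Pi.single i s ∈ S ∧
      s + ∑ l ∈ Finset.univ.erase i, c l = h i ∧ ∀ l, l ≠ i → c l * k l ≤ h l := fun x hx =>
      ⟨0, x, hx ▸ hh.1, by simp [hx], by simp⟩
    rcases D.atom_cases h hh with h1 | h1 | ⟨m, hm, h1⟩ | ⟨m, hm, h1⟩ | h1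
    · exact axis _ h1
    · exact axis _ h1
    · exact ⟨0, 0, by simp, by simp [h1, hm.symm], by simp⟩
    · refine ⟨Pi.single m 1, 0, by simp, ?_, fun l hl => ?_⟩
      · rw [Finset.sum_pi_single']
        simp [h1, hm, hm.symm]
      · by_cases hlm : l = m
        · subst hlm; simp [h1]
        · simp [hlm]
    · exact axis _ (h1.trans hv)
  | zero => exact ⟨0, 0, by simp, by simp, by simp⟩
  | add y z _ _ ihy ihz =>
    obtain ⟨c, s, hs, h1, h2⟩ := ihy
    obtain ⟨c', s', hs', h1', h2'⟩ := ihz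
    refine ⟨c + c', s + s', by rw [Pi.single_add]; exact add_mem hs hs', ?_, fun l hl => ?_⟩
    · simp only [Pi.add_apply, Finset.sum_add_distrib]
      omega
    · have := h2 l hl
      have := h2' l hl
      simp only [Pi.add_apply, add_mul]
      omega

theorem exists_weight (D : OneAxisData S f i p q k v) {t : ℕ} (hv : v = Pi.single i t)
    {j : Fin d} (hj : j ≠ i) {x y : ℕ} (h : Pi.single i x + Pi.single j y ∈ S) :
    ∃ c ≤ x, Pi.single i (x - c) ∈ S ∧ c * k j ≤ y := by
  obtain ⟨c, s, hs, h1, h2⟩ := D.exists_weights hv h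
  have h0 : ∀ l ∈ Finset.univ.erase i, l ≠ j → c l = 0 := by
    intro l hl hlj
    have hl' : l ≠ i := by simpa using hl
    have := h2 l hl'
    simp [hl', hlj] at this
    have := D.k_pos l hl'
    omega
  rw [Finset.sum_eq_single_of_mem j (by simp [hj]) h0] at h1
  have h3 := h2 j hj
  simp [hj.symm, hj] at h1 h3
  refine ⟨c j, by omega, ?_, h3⟩
  rw [← h1, Nat.add_sub_cancel]
  exact hs

theorem mem_of_weight (D : OneAxisData S f i p q k v) {j : Fin d} (hj : j ≠ i) {x c : ℕ}
    (hc : c ≤ x) (h : Pi.single i (x - c) ∈ S) : Pi.single i x + Pi.single j (c * k j) ∈ S := by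
  have := add_mem h (nsmul_mem (D.atom_k j hj).1 c)
  convert this using 1
  rw [nsmul_add, ← add_assoc, ← Pi.single_smul, ← Pi.single_smul, ← Pi.single_add]
  simp [Nat.sub_add_cancel hc]

/-- If 2 were on the axis, then p = 2 and the axis could carry only one further atom, the least odd
element. But q and t would be two. -/
theorem two_notMem_of_on_axis (D : OneAxisData S f i p q k v) {t : ℕ} (hv : v = Pi.single i t) :
    Pi.single i 2 ∉ S := by
  intro h2
  have hp : p = 2 := by
    have := D.p_le 2 two_pos h2
    have := D.one_lt
    omega
  have heven : ∀ m, Pi.single i (2 * m) ∈ S := fun m => by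
    simpa [← Pi.single_smul, mul_comm] using nsmul_mem h2 m
  have key : ∀ x y, IsAtomOf S (Pi.single i x) → Pi.single i y ∈ S → y ≤ x → (x - y) % 2 = 0 →
      y = 0 ∨ y = x := by
    intro x y hx hy hle hm
    have e : x - y = 2 * ((x - y) / 2) := by omega
    have := hx.2.2 _ hy _ (heven ((x - y) / 2)) (by
      rw [← e, ← Pi.single_add, Nat.add_sub_cancel' hle])
    simp at this
    omega
  have hq := D.not_dvd
  have hvp := D.v_ne_p
  have hvq := D.v_ne_q
  have hva := D.atom_v
  rw [hv] at hvp hvq hva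
  rw [hp] at hvp hq
  have htq : t ≠ q := fun h => hvq (h ▸ rfl)
  have ht2 : t ≠ 2 := fun h => hvp (h ▸ rfl)
  have ht0 : t ≠ 0 := fun h => hva.2.1 (by simp [h])
  by_cases ht : t % 2 = 0
  · have := key t 2 hva h2 (by omega) (by omega)
    omega
  · rcases le_total q t with h | h
    · have := key t q hva D.atom_q.1 h (by omega)
      omega
    · have := key q t D.atom_q hva.1 h (by omega)
      omega

theorem firstFamily_of_on_axis (hd : 1 < d) (D : OneAxisData S f i p q k v) {t : ℕ}
    (hv : v = Pi.single i t) :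
    d = 2 ∧ ∃ j a, i ≠ j ∧ 3 < a ∧ 0 < k j ∧ a % 3 = 1 ∧ S = firstFamily i j a (k j) := by
  classical
  have h1 := D.one_notMem
  have h2 := D.two_notMem_of_on_axis hv
  have hex : ∃ n, n ≤ f i ∧ Pi.single i (f i - n) ∈ S := ⟨f i, le_rfl, by simp⟩
  obtain ⟨hn, hnS⟩ := Nat.find_spec hex
  have hmin := fun m => Nat.find_min' (m := m) hex
  generalize Nat.find hex = n at hn hnS hmin
  have hf : ∀ j, j ≠ i → f j + 1 = n * k j := by
    intro j hj
    apply le_antisymm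
    · by_contra! hlt
      refine D.not_le_of_mem (D.mem_of_weight hj hn hnS) (by simp [hj.symm]) fun m => ?_
      by_cases hm : m = i
      · subst hm; simp [hj.symm]
      · by_cases hm' : m = j
        · subst hm'; simp [hm]; omega
        · simp [hm, hm']
    · obtain ⟨c, hc, hcS, hck⟩ := D.exists_weight hv hj (x := f i) (y := f j + 1)
        (D.mem_of_lt j (by simp [hj]))
      exact (Nat.mul_le_mul_right _ (hmin c ⟨hc, hcS⟩)).trans hck
  obtain ⟨j, hj⟩ : ∃ j, j ≠ i := by
    have : Nontrivial (Fin d) := Fin.nontrivial_iff_two_le.2 hd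
    exact exists_ne i
  have hkj := D.k_pos j hj
  have hweight : ∀ x, ∃ c ≤ x, c ≤ n ∧ Pi.single i (x - c) ∈ S := by
    intro x
    obtain ⟨c, hc, hcS, hck⟩ := D.exists_weight hv hj (x := x) (y := f j + 1)
        (D.mem_of_lt j (by simp [hj]))
    rw [hf j hj] at hck
    exact ⟨c, hc, Nat.le_of_mul_le_mul_right hck hkj, hcS⟩
  have hpgt := D.one_lt
  have hn2 : 2 ≤ n := by
    obtain ⟨c, hc, hcn, hcS⟩ := hweight 2
    by_contra hlt
    obtain rfl | rfl : c = 0 ∨ c = 1 := by omega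
    · exact h2 hcS
    · exact h1 hcS
  have hall : ∀ l, l ≠ i → l = j := by
    intro l hl
    by_contra hlj
    have hkl := D.k_pos l hl
    -- Using n - 1 copies in direction l and one in direction j reaches first coordinate f i with
    -- heights (n-1)k_l ≤ f l and k_j ≤ f j.
    have e1 := D.mem_of_weight (x := f i - 1) (c := n - 1) hl (by omega) (by
      have : f i - 1 - (n - 1) = f i - n := by omega
      rw [this]; exact hnS)
    refine D.not_le_of_mem (add_mem e1 (D.atom_k j hj).1) ?_ fun m => ?_
    · simp [hj.symm, hl.symm]; omega
    · have ej := hf j hj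
      have el := hf l hl
      obtain ⟨r, rfl⟩ : ∃ r, n = r + 2 := ⟨n - 2, by omega⟩
      rw [add_mul] at ej el
      by_cases hm : m = i
      · subst hm; simp [hj.symm, hl.symm]; omega
      · by_cases hm' : m = j
        · subst hm'; simp [hm, Ne.symm hlj]
          have := Nat.zero_le (r * k m)
          omega
        · by_cases hm'' : m = l
          · subst hm''; simp [hm, hm', add_mul]; omega
          · simp [hm, hm', hm'']
  -- Below p the only axis element is 0, so first coordinate p - 1 needs weight exactly p - 1, while
  -- n always suffices.
  have hpn : p ≤ n + 1 := by
    obtain ⟨c, hc, hcn, hcS⟩ := hweight (p - 1)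
    by_contra hlt
    have := D.p_le (p - 1 - c) (by omega) hcS
    omega
  have hpF : p ≤ f i + 1 := by omega
  obtain ⟨hdvd, habove⟩ := dvd_and_atoms_above_of_gaps
    (T := S.comap (AddMonoidHom.single (fun _ => ℕ) i)) (F := f i) (p := p)
    D.atom_p.1 (by omega) D.p_le (fun m hm hmF h => by
      have := hmin m ⟨hmF, h⟩
      omega)
  have hatom : ∀ m, 0 < m → m < p → f i + 1 + m = q ∨ f i + 1 + m = t := by
    intro m hm hmp
    have hat : IsAtomOf S (Pi.single i (f i + 1 + m)) :=
      isAtomOf_single (D.mem_of_lt i (by simp; omega)) (by omega)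
        fun y z hy hz hyz => habove m hm hmp y hy z hz hyz
    rcases D.atom_cases _ hat with h | h | ⟨l, hl, h⟩ | ⟨l, hl, h⟩ | h
    · have := congrFun h i
      simp at this
      omega
    · have := congrFun h i
      simp at this
      exact Or.inl this
    · have := congrFun h i
      simp [hl.symm] at this
    · have := congrFun h i
      simp [hl.symm] at this
      omega
    · have := congrFun (h.trans hv) i
      simp at this
      exact Or.inr this
  have hp3 : p = 3 := by
    have e2 : p ≠ 2 := fun h => h2 (h ▸ D.atom_p.1)
    -- For p ≥ 4 there would be three distinct atoms f i + 2, f i + 3, f i + 4 among q and t.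
    by_contra h
    have a1 := hatom 1 (by omega) (by omega)
    have a2 := hatom 2 (by omega) (by omega)
    have a3 := hatom 3 (by omega) (by omega)
    omega
  subst hp3
  have a1 := hatom 1 (by omega) (by omega)
  have a2 := hatom 2 (by omega) (by omega)
  refine ⟨eq_two_of_forall_eq_or_eq hj.symm hall, j, f i + 2, hj.symm, by omega, hkj, by omega,
    le_antisymm ?_ ?_⟩
  · conv_lhs => rw [← D.closure_atoms]
    refine AddSubmonoid.closure_mono fun x hx => ?_
    simp only [Set.mem_insert_iff, Set.mem_singleton_iff]
    have hqt : (q = f i + 2 ∨ q = f i + 2 + 1) ∧ (t = f i + 2 ∨ t = f i + 2 + 1) := by omega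
    rcases D.atom_cases x hx with h | h | ⟨m, hm, h⟩ | ⟨m, hm, h⟩ | h
    · simp [h]
    · rcases hqt.1 with h' | h' <;> rw [h, h'] <;> simp
    · rw [hall m hm] at h; simp [h]
    · rw [hall m hm] at h; simp [h]
    · rcases hqt.2 with h' | h' <;> rw [h, hv, h'] <;> simp
  · refine AddSubmonoid.closure_le.2 fun x hx => ?_
    simp only [Set.mem_insert_iff, Set.mem_singleton_iff] at hx
    rcases hx with rfl | rfl | rfl | rfl | rfl
    · exact D.atom_p.1
    · exact D.mem_of_lt i (by simp)
    · exact D.mem_of_lt i (by simp)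
    · exact D.unit_mem j hj
    · exact (D.atom_k j hj).1

end OneAxisData

/-! ### From symmetry to a unique maximal gap, and conclusion -/

section UniqueMaximalGap

variable {d : ℕ} {S : AddSubmonoid (Fin d → ℕ)}

theorem frobeniusAllowableSet_subset_pseudoFrobeniusSet :
    frobeniusAllowableSet S ⊆ pseudoFrobeniusSet S := by
  intro h hh
  refine ⟨hh.1, fun s _ hs0 => ?_⟩
  by_contra hn
  have h1 : h + s ≤ h := hh.2 hn le_self_add
  apply hs0
  ext l
  have := h1 l
  simp only [Pi.add_apply, Pi.zero_apply] at *
  omega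

theorem IsGNS.exists_le_mem_frobeniusAllowableSet (hS : IsGNS S) {h : Fin d → ℕ} (hh : h ∉ S) :
    ∃ f ∈ frobeniusAllowableSet S, h ≤ f := by
  obtain ⟨f, hle, hf⟩ := Set.Finite.exists_le_maximal hS (a := h) hh
  exact ⟨f, hf, hle⟩

theorem IsSymmetricGNS.exists_eq_singleton (hS : IsGNS S) (hsym : IsSymmetricGNS S) :
    ∃ f, pseudoFrobeniusSet S = {f} ∧ frobeniusAllowableSet S = {f} := by
  obtain ⟨f, hf⟩ := Set.ncard_eq_one.1 hsym
  refine ⟨f, hf, ?_⟩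
  have hfS : f ∈ pseudoFrobeniusSet S := by rw [hf]; rfl
  obtain ⟨g, hg, -⟩ := hS.exists_le_mem_frobeniusAllowableSet hfS.1
  have hsub := frobeniusAllowableSet_subset_pseudoFrobeniusSet (S := S)
  rw [hf] at hsub
  exact hsub.antisymm (Set.singleton_subset_iff.2 ((hsub hg) ▸ hg))

theorem IsSymmetricGNS.isAlmostSymmetricGNS (hS : IsGNS S) (hsym : IsSymmetricGNS S) :
    IsAlmostSymmetricGNS S := by
  obtain ⟨f, hf, hf'⟩ := hsym.exists_eq_singleton hS
  refine ⟨f, hf', fun p hp hpf => ?_⟩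
  rw [hf] at hp
  exact absurd hp hpf

theorem family_of_frobeniusAllowableSet_eq_singleton (hd : 1 < d) (hS : IsGNS S)
    (hE : HasEmbeddingDimension S (2 * d + 1)) {f : Fin d → ℕ}
    (hf : frobeniusAllowableSet S = {f}) :
    d = 2 ∧ ∃ i j : Fin d, i ≠ j ∧ ∃ a b : ℕ, 3 < a ∧ 0 < b ∧
      ((a % 3 = 1 ∧ S = firstFamily i j a b) ∨
        (Nat.Coprime 3 a ∧ S = secondFamily i j a b)) := by
  obtain ⟨A, hA, hcard⟩ := hE
  have hfS : f ∈ frobeniusAllowableSet S := by rw [hf]; rfl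
  obtain ⟨i, p, q, k, v, D⟩ := exists_oneAxisData hA.1
    (fun x => ⟨fun h => hA.isAtomOf (Finset.mem_coe.2 h), fun h => h.mem_of_closure_eq hA.1⟩)
    hcard hfS.1 (fun h hh => by
      obtain ⟨g, hg, hle⟩ := hS.exists_le_mem_frobeniusAllowableSet hh
      rw [hf] at hg
      exact hg ▸ hle)
  by_cases hv : v = Pi.single i (v i)
  · obtain ⟨h2, j, a, hij, ha, hb, ha3, h⟩ := D.firstFamily_of_on_axis hd hv
    exact ⟨h2, i, j, hij, a, k j, ha, hb, Or.inl ⟨ha3, h⟩⟩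
  · obtain ⟨h2, j, hij, ha, hb, ha3, h⟩ := D.secondFamily_of_off_axis hv
    exact ⟨h2, i, j, hij, q, k j, ha, hb, Or.inr ⟨ha3, h⟩⟩

theorem properties_of_family (h : d = 2 ∧ ∃ i j : Fin d, i ≠ j ∧ ∃ a b : ℕ, 3 < a ∧ 0 < b ∧
      ((a % 3 = 1 ∧ S = firstFamily i j a b) ∨
        (Nat.Coprime 3 a ∧ S = secondFamily i j a b))) :
    IsGNS S ∧ HasEmbeddingDimension S (2 * d + 1) ∧ IsSymmetricGNS S := by
  obtain ⟨rfl, i, j, hij, a, b, ha, hb, ⟨ha3, rfl⟩ | ⟨ha3, rfl⟩⟩ := h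
  · exact firstFamily_properties hij ha hb ha3
  · have := (Nat.Prime.coprime_iff_not_dvd Nat.prime_three).1 ha3
    exact secondFamily_properties hij ha hb (by omega)

end UniqueMaximalGap

theorem mainTheorem1 (d : ℕ) (hd : 1 < d) (S : AddSubmonoid (Fin d → ℕ)) :
    (IsGNS S → HasEmbeddingDimension S (2 * d + 1) →
      (IsSymmetricGNS S ↔ (frobeniusAllowableSet S).ncard = 1) ∧
      (IsAlmostSymmetricGNS S ↔ IsSymmetricGNS S)) ∧
    ((IsGNS S ∧ HasEmbeddingDimension S (2 * d + 1) ∧ IsSymmetricGNS S) ↔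
      d = 2 ∧ ∃ i j : Fin d, i ≠ j ∧ ∃ a b : ℕ, 3 < a ∧ 0 < b ∧
        ((a % 3 = 1 ∧ S = firstFamily i j a b) ∨
          (Nat.Coprime 3 a ∧ S = secondFamily i j a b))) := by
  refine ⟨fun hS hE => ⟨⟨fun h => ?_, fun h => ?_⟩, ⟨fun h => ?_, fun h => ?_⟩⟩,
    ⟨fun h => ?_, properties_of_family⟩⟩
  · obtain ⟨f, -, hf⟩ := h.exists_eq_singleton hS
    rw [hf, Set.ncard_singleton]
  · obtain ⟨f, hf⟩ := Set.ncard_eq_one.1 h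
    exact (properties_of_family (family_of_frobeniusAllowableSet_eq_singleton hd hS hE hf)).2.2
  · obtain ⟨f, hf, -⟩ := h
    exact (properties_of_family (family_of_frobeniusAllowableSet_eq_singleton hd hS hE hf)).2.2
  · exact h.isAlmostSymmetricGNS hS
  · obtain ⟨f, -, hf⟩ := h.2.2.exists_eq_singleton h.1
    exact family_of_frobeniusAllowableSet_eq_singleton hd h.1 h.2.1 hf
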